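/- Composition is written diagrammatically: $p;q$ means first $p$, then $q$. All coproducts are selected binary coproducts $X\oplus Y$ with injections $\mathsf{inl},\mathsf{inr}$ and copairing $[-,-]$. **Definitions.** An *idempotent grove category with coproducts* is a category with coproducts whose hom-sets are bounded join-semilattices $(0,+)$ such that $0;p=0$ and $(q+r);p=q;p+r;p$, and whose injections are linear, where $p$ is *linear* if $p;0=0$ and $p;(q+r)=p;q+p;r$ for all $q,r$. A *Kleene-iteration category (KiC)* is a pair $(\mathbf C,\overline{\mathbf C})$ of an idempotent grove category with coproducts $\mathbf C$ and a wide subcategory $\overline{\mathbf C}$ of *tame* morphisms, which are all linear and which has coproducts strictly preserved by the inclusion, together with operators $(-)^*\colon\mathbf C(X,X)\to\mathbf C(X,X)$ such that $p^*=\mathrm{id}+p;p^*$, $(p+q)^*=p^*;(q;p^*)^*$, and $u;p=q;u$ implies $u;p^*=q^*;u$ for all tame $u$. Let $\mathbf V$ be a category with coproducts, $\mathbb T=(T,\eta,(-)^\star)$ a monad on $\mathbf V$ (with $(-)^\star$ its Kleisli lifting) and $H\colon\mathbf V\to\mathbf V$ a functor such that a final coalgebra $\mathsf{out}\colon T_HX\to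 T(X\oplus HT_HX)$ of $\gamma\mapsto T(X\oplus H\gamma)$ exists for every $X$. Let $\mathbb T_H$ be the resulting monad $X\mapsto T_HX=\nu\gamma.\,T(X\oplus H\gamma)$: its unit is $\mathsf{inl};\eta;\mathsf{out}^{-1}$ and its Kleisli lifting $f^{\widehat\star}\colon T_HX\to T_HY$ of $f\colon X\to T_HY$ is the unique solution of $f^{\widehat\star};\mathsf{out}=\mathsf{out};[f;\mathsf{out},\,Hf^{\widehat\star};\mathsf{inr};\eta]^\star$. **Theorem.** Suppose that the Kleisli category $\mathbf V_{\mathbb T}$ (with the coproducts inherited from $\mathbf V$) carries a KiC structure $(\mathbf V_{\mathbb T},\overline{\mathbf C})$ such that (Z) either $0\colon X\to X$ is tame for every $X$, or $f;\eta$ is tame for every morphism $f$ of $\mathbf V$. Then $\mathbf V_{\mathbb T}$ is a wide subcategory of $\mathbf V_{\mathbb T_H}$ via the identity-on-objects faithful functor $J\colon f\mapsto f;T\mathsf{inl};\mathsf{out}^{-1}$, and $(\mathbf V_{\mathbb T_H},J\overline{\mathbf C})$ is a KiC with respect to the coproducts inherited from $\mathbf V$ and the following structure: * the bottom element of $\mathbf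 V(X,T_HY)$ is $0;\mathsf{out}^{-1}$, and the join of $p,q\in\mathbf V(X,T_HY)$ is $(p;\mathsf{out}+q;\mathsf{out});\mathsf{out}^{-1}$; * for $p\in\mathbf V(X,T_HX)$, the iteration $p^*\in\mathbf V(X,T_HX)$ is the unique solution of $$p^*;\mathsf{out}=\mathsf{inl};[p;\mathsf{out},0]^*;T\bigl(\mathrm{id}\oplus H(p^*)^{\widehat\star}\bigr),$$ where $[p;\mathsf{out},0]^*$ is the iteration in $\mathbf V_{\mathbb T}$ of the endomorphism $[p;\mathsf{out},0]$ of $X\oplus HT_HX$. Moreover, the KiC $(\mathbf V_{\mathbb T_H},J\overline{\mathbf C})$ again satisfies (Z). -/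

import Mathlib

open CategoryTheory CategoryTheory.Limits

universe v u

namespace Resumption

/-! ### Categories with selected binary coproducts -/

/-- A selection of a binary coproduct `X ⊕ Y` for every two objects `X`, `Y`. -/
structure SelectedCoproducts (C : Type u) [Category.{v} C] where
  /-- The selected coproduct `X ⊕ Y`. -/
  sum : C → C → C
  /-- The left injection. -/
  inl : ∀ X Y : C, X ⟶ sum X Y
  /-- The right injection. -/
  inr : ∀ X Y : C, Y ⟶ sum X Y
  isColimit : ∀ X Y : C, IsColimit (BinaryCofan.mk (inl X Y) (inr X Y))

namespace SelectedCoproducts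

variable {C : Type u} [Category.{v} C] (S : SelectedCoproducts C)

/-- The copairing `[f, g]`. -/
def desc {X Y Z : C} (f : X ⟶ Z) (g : Y ⟶ Z) : S.sum X Y ⟶ Z :=
  (S.isColimit X Y).desc (BinaryCofan.mk f g)

@[simp]
theorem inl_desc {X Y Z : C} (f : X ⟶ Z) (g : Y ⟶ Z) : S.inl X Y ≫ S.desc f g = f :=
  (S.isColimit X Y).fac (BinaryCofan.mk f g) ⟨WalkingPair.left⟩

@[simp]
theorem inl_desc_assoc {X Y Z W : C} (f : X ⟶ Z) (g : Y ⟶ Z) (h : Z ⟶ W) :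
    S.inl X Y ≫ S.desc f g ≫ h = f ≫ h := by rw [← Category.assoc, inl_desc]

@[simp]
theorem inr_desc {X Y Z : C} (f : X ⟶ Z) (g : Y ⟶ Z) : S.inr X Y ≫ S.desc f g = g :=
  (S.isColimit X Y).fac (BinaryCofan.mk f g) ⟨WalkingPair.right⟩

@[simp]
theorem inr_desc_assoc {X Y Z W : C} (f : X ⟶ Z) (g : Y ⟶ Z) (h : Z ⟶ W) :
    S.inr X Y ≫ S.desc f g ≫ h = g ≫ h := by rw [← Category.assoc, inr_desc]

theorem hom_ext {X Y Z : C} {f g : S.sum X Y ⟶ Z} (h₁ : S.inl X Y ≫ f = S.inl X Y ≫ g)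
    (h₂ : S.inr X Y ≫ f = S.inr X Y ≫ g) : f = g :=
  BinaryCofan.IsColimit.hom_ext (S.isColimit X Y) h₁ h₂

theorem desc_comp {X Y Z W : C} (f : X ⟶ Z) (g : Y ⟶ Z) (h : Z ⟶ W) :
    S.desc f g ≫ h = S.desc (f ≫ h) (g ≫ h) :=
  S.hom_ext (by simp) (by simp)

/-- The action `f ⊕ g` of the coproduct on morphisms. -/
def map {X Y X' Y' : C} (f : X ⟶ X') (g : Y ⟶ Y') : S.sum X Y ⟶ S.sum X' Y' :=
  S.desc (f ≫ S.inl X' Y') (g ≫ S.inr X' Y')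

@[simp]
theorem inl_map {X Y X' Y' : C} (f : X ⟶ X') (g : Y ⟶ Y') :
    S.inl X Y ≫ S.map f g = f ≫ S.inl X' Y' := S.inl_desc _ _

@[simp]
theorem inl_map_assoc {X Y X' Y' W : C} (f : X ⟶ X') (g : Y ⟶ Y') (h : S.sum X' Y' ⟶ W) :
    S.inl X Y ≫ S.map f g ≫ h = f ≫ S.inl X' Y' ≫ h := by
  rw [← Category.assoc, inl_map, Category.assoc]

@[simp]
theorem inr_map {X Y X' Y' : C} (f : X ⟶ X') (g : Y ⟶ Y') :
    S.inr X Y ≫ S.map f g = g ≫ S.inr X' Y' := S.inr_desc _ _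

@[simp]
theorem inr_map_assoc {X Y X' Y' W : C} (f : X ⟶ X') (g : Y ⟶ Y') (h : S.sum X' Y' ⟶ W) :
    S.inr X Y ≫ S.map f g ≫ h = g ≫ S.inr X' Y' ≫ h := by
  rw [← Category.assoc, inr_map, Category.assoc]

end SelectedCoproducts

/-! ### Kleene-iteration categories

Composition is written in diagrammatic order, `p ≫ q` is "first `p`, then `q`". -/

/-- The structure of an idempotent grove category: hom-sets are bounded join-semilattices
`(0, +)`, and `0 ; p = 0` and `(q + r) ; p = q ; p + r ; p`. -/
structure IdempotentGrove (C : Type u) [Category.{v} C] where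
  zero : ∀ X Y : C, X ⟶ Y
  add : ∀ {X Y : C}, (X ⟶ Y) → (X ⟶ Y) → (X ⟶ Y)
  zero_add : ∀ {X Y : C} (p : X ⟶ Y), add (zero X Y) p = p
  add_self : ∀ {X Y : C} (p : X ⟶ Y), add p p = p
  add_comm : ∀ {X Y : C} (p q : X ⟶ Y), add p q = add q p
  add_assoc : ∀ {X Y : C} (p q r : X ⟶ Y), add (add p q) r = add p (add q r)
  zero_comp : ∀ (X : C) {Y Z : C} (p : Y ⟶ Z), zero X Y ≫ p = zero X Z
  add_comp : ∀ {X Y Z : C} (q r : X ⟶ Y) (p : Y ⟶ Z), add q r ≫ p = add (q ≫ p) (r ≫ p)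

/-- A morphism `p` is linear if `p ; 0 = 0` and `p ; (q + r) = p ; q + p ; r`. -/
def IdempotentGrove.IsLinear {C : Type u} [Category.{v} C] (G : IdempotentGrove C) {X Y : C}
    (p : X ⟶ Y) : Prop :=
  (∀ Z : C, p ≫ G.zero Y Z = G.zero X Z) ∧
    ∀ (Z : C) (q r : Y ⟶ Z), p ≫ G.add q r = G.add (p ≫ q) (p ≫ r)

/-- The structure of a Kleene-iteration category (KiC) on a category `C` with selected
coproducts. The wide subcategory of tame morphisms is given by the class `tame`;
it contains the injections and is closed under copairing, that is, it has coproducts strictly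
preserved by the inclusion. -/
structure KiC (C : Type u) [Category.{v} C] (S : SelectedCoproducts C) extends
    IdempotentGrove C where
  inl_linear : ∀ X Y : C, toIdempotentGrove.IsLinear (S.inl X Y)
  inr_linear : ∀ X Y : C, toIdempotentGrove.IsLinear (S.inr X Y)
  tame : MorphismProperty C
  tame_id : ∀ X : C, tame (𝟙 X)
  tame_comp : ∀ {X Y Z : C} (f : X ⟶ Y) (g : Y ⟶ Z), tame f → tame g → tame (f ≫ g)
  tame_inl : ∀ X Y : C, tame (S.inl X Y)
  tame_inr : ∀ X Y : C, tame (S.inr X Y)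
  tame_desc : ∀ {X Y Z : C} (f : X ⟶ Z) (g : Y ⟶ Z), tame f → tame g → tame (S.desc f g)
  tame_linear : ∀ {X Y : C} (f : X ⟶ Y), tame f → toIdempotentGrove.IsLinear f
  star : ∀ {X : C}, (X ⟶ X) → (X ⟶ X)
  star_fix : ∀ {X : C} (p : X ⟶ X), star p = add (𝟙 X) (p ≫ star p)
  star_sum : ∀ {X : C} (p q : X ⟶ X), star (add p q) = star p ≫ star (q ≫ star p)
  star_uni : ∀ {X Y : C} (u : X ⟶ Y) (p : Y ⟶ Y) (q : X ⟶ X), tame u →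
    u ≫ p = q ≫ u → u ≫ star p = star q ≫ u

/-! ### Kleisli lifting and coproducts in Kleisli categories -/

section Kleisli

variable {V : Type u} [Category.{v} V]

/-- The unit `η : X ⟶ T X`. -/
def eta (T : Monad V) (X : V) : X ⟶ T.obj X := T.η.app X

theorem eta_naturality (T : Monad V) {X Y : V} (f : X ⟶ Y) :
    f ≫ eta T Y = eta T X ≫ T.map f := T.η.naturality f

/-- The Kleisli lifting `f⋆ : T X ⟶ T Y` of `f : X ⟶ T Y`. -/
def klift (T : Monad V) {X Y : V} (f : X ⟶ T.obj Y) : T.obj X ⟶ T.obj Y :=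
  T.map f ≫ T.μ.app Y

@[simp]
theorem unit_klift (T : Monad V) {X Y : V} (f : X ⟶ T.obj Y) : eta T X ≫ klift T f = f := by
  have h : eta T (T.obj Y) ≫ T.μ.app Y = 𝟙 _ := T.left_unit Y
  rw [klift, ← Category.assoc, ← eta_naturality, Category.assoc, h, Category.comp_id]

@[simp]
theorem unit_klift_assoc (T : Monad V) {X Y Z : V} (f : X ⟶ T.obj Y) (h : T.obj Y ⟶ Z) :
    eta T X ≫ klift T f ≫ h = f ≫ h := by rw [← Category.assoc, unit_klift]

@[simp]
theorem klift_unit (T : Monad V) (X : V) : klift T (eta T X) = 𝟙 (T.obj X) := T.right_unit X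

theorem klift_klift (T : Monad V) {X Y Z : V} (f : X ⟶ T.obj Y) (g : Y ⟶ T.obj Z) :
    klift T f ≫ klift T g = klift T (f ≫ klift T g) := by
  simp [klift, T.assoc, T.mu_naturality_assoc]

theorem map_klift (T : Monad V) {X Y Z : V} (f : X ⟶ Y) (g : Y ⟶ T.obj Z) :
    T.map f ≫ klift T g = klift T (f ≫ g) := by
  simp [klift]

theorem map_klift_assoc (T : Monad V) {X Y Z W : V} (f : X ⟶ Y) (g : Y ⟶ T.obj Z)
    (h : T.obj Z ⟶ W) : T.map f ≫ klift T g ≫ h = klift T (f ≫ g) ≫ h := by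
  rw [← Category.assoc, map_klift]

theorem klift_map (T : Monad V) {X Y Z : V} (f : X ⟶ T.obj Y) (g : Y ⟶ Z) :
    klift T f ≫ T.map g = klift T (f ≫ T.map g) := by
  simp [klift, T.mu_naturality]

/-- The monad determined by a Kleisli triple. -/
def monadOfTriple (T : V → V) (unit : ∀ X : V, X ⟶ T X)
    (lift : ∀ {X Y : V}, (X ⟶ T Y) → (T X ⟶ T Y))
    (lift_unit : ∀ X : V, lift (unit X) = 𝟙 (T X))
    (unit_lift : ∀ {X Y : V} (f : X ⟶ T Y), unit X ≫ lift f = f)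
    (lift_lift : ∀ {X Y Z : V} (g : X ⟶ T Y) (f : Y ⟶ T Z),
      lift g ≫ lift f = lift (g ≫ lift f)) : Monad V where
  obj := T
  map {_ Y} f := lift (f ≫ unit Y)
  map_id X := by simp [lift_unit]
  map_comp f g := by simp [lift_lift, unit_lift]
  η := { app := unit, naturality := by intro X Y f; simp [unit_lift] }
  μ :=
    { app := fun X => lift (𝟙 (T X))
      naturality := by intro X Y f; simp [lift_lift, unit_lift] }
  assoc X := by simp [lift_lift, unit_lift]
  left_unit X := by simp [unit_lift]
  right_unit X := by simp [lift_lift, unit_lift, lift_unit]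

/-- The coproducts of the Kleisli category of `T`, with injections `inl ; η` and `inr ; η`. -/
def kleisliCoproducts (T : Monad V) (S : SelectedCoproducts V) :
    SelectedCoproducts (Kleisli T) where
  sum X Y := Kleisli.mk T (S.sum X.of Y.of)
  inl X Y := ⟨S.inl X.of Y.of ≫ eta T (S.sum X.of Y.of)⟩
  inr X Y := ⟨S.inr X.of Y.of ≫ eta T (S.sum X.of Y.of)⟩
  isColimit X Y := BinaryCofan.IsColimit.mk _
    (fun f g => ⟨S.desc f.of g.of⟩)
    (fun f g => by
      apply Kleisli.hom_ext
      change (S.inl _ _ ≫ eta T _) ≫ klift T (S.desc f.of g.of) = f.of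
      simp)
    (fun f g => by
      apply Kleisli.hom_ext
      change (S.inr _ _ ≫ eta T _) ≫ klift T (S.desc f.of g.of) = g.of
      simp)
    (fun {Z} f g m hf hg => by
      apply Kleisli.hom_ext
      let m' : S.sum X.of Y.of ⟶ T.obj Z.of := m.of
      have hf' : (S.inl X.of Y.of ≫ eta T _) ≫ klift T m' = f.of := congrArg Kleisli.Hom.of hf
      have hg' : (S.inr X.of Y.of ≫ eta T _) ≫ klift T m' = g.of := congrArg Kleisli.Hom.of hg
      change m' = S.desc f.of g.of
      apply S.hom_ext
      · rw [S.inl_desc, ← hf', Category.assoc, unit_klift]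
      · rw [S.inr_desc, ← hg', Category.assoc, unit_klift])

end Kleisli

/-! ### The generalized coalgebraic resumption monad transformer -/

section Resumptions

variable {V : Type u} [Category.{v} V]

/-- The functor `γ ↦ T (X ⊕ H γ)`. -/
def resFunctor (T : Monad V) (S : SelectedCoproducts V) (H : V ⥤ V) (X : V) : V ⥤ V where
  obj γ := T.obj (S.sum X (H.obj γ))
  map g := T.map (S.map (𝟙 X) (H.map g))
  map_id γ := by
    rw [← T.map_id]; congr 1; apply S.hom_ext <;> simp
  map_comp f g := by
    rw [← T.map_comp]; congr 1; apply S.hom_ext <;> simp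

/-- A selection of final coalgebras `ν γ. T (X ⊕ H γ)`, one for every object `X`. -/
structure FinalCoalgebras (T : Monad V) (S : SelectedCoproducts V) (H : V ⥤ V) where
  coalg : ∀ X : V, Endofunctor.Coalgebra (resFunctor T S H X)
  isTerminal : ∀ X : V, IsTerminal (coalg X)

namespace FinalCoalgebras

variable {T : Monad V} {S : SelectedCoproducts V} {H : V ⥤ V} (N : FinalCoalgebras T S H)

/-- The object `T_H X = ν γ. T (X ⊕ H γ)`. -/
def carrier (X : V) : V := (N.coalg X).V

/-- The structure morphism of the final coalgebra. -/
def out (X : V) : N.carrier X ⟶ T.obj (S.sum X (H.obj (N.carrier X))) := (N.coalg X).str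

/-- The inverse of `out` (Lambek's lemma). -/
def outInv (X : V) : T.obj (S.sum X (H.obj (N.carrier X))) ⟶ N.carrier X :=
  Endofunctor.Coalgebra.Terminal.strInv (N.isTerminal X)

@[simp]
theorem out_outInv (X : V) : N.out X ≫ N.outInv X = 𝟙 _ :=
  Endofunctor.Coalgebra.Terminal.right_inv (N.isTerminal X)

@[simp]
theorem out_outInv_assoc (X : V) {W : V} (h : N.carrier X ⟶ W) :
    N.out X ≫ N.outInv X ≫ h = h := by rw [← Category.assoc, out_outInv, Category.id_comp]

@[simp]
theorem outInv_out (X : V) : N.outInv X ≫ N.out X = 𝟙 _ :=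
  Endofunctor.Coalgebra.Terminal.left_inv (N.isTerminal X)

@[simp]
theorem outInv_out_assoc (X : V) {W : V} (h : T.obj (S.sum X (H.obj (N.carrier X))) ⟶ W) :
    N.outInv X ≫ N.out X ≫ h = h := by rw [← Category.assoc, outInv_out, Category.id_comp]

theorem cancel_out {X Y : V} {f g : X ⟶ N.carrier Y} (h : f ≫ N.out Y = g ≫ N.out Y) : f = g := by
  have := congrArg (fun k => k ≫ N.outInv Y) h
  simpa using this

/-- The unique morphism from a coalgebra to the final one. -/
def unfold {X A : V} (c : A ⟶ T.obj (S.sum X (H.obj A))) : A ⟶ N.carrier X :=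
  ((N.isTerminal X).from (⟨A, c⟩ : Endofunctor.Coalgebra (resFunctor T S H X))).f

theorem unfold_out {X A : V} (c : A ⟶ T.obj (S.sum X (H.obj A))) :
    N.unfold c ≫ N.out X = c ≫ T.map (S.map (𝟙 X) (H.map (N.unfold c))) :=
  ((N.isTerminal X).from (⟨A, c⟩ : Endofunctor.Coalgebra (resFunctor T S H X))).h.symm

theorem unfold_unique {X A : V} (c : A ⟶ T.obj (S.sum X (H.obj A))) (g : A ⟶ N.carrier X)
    (h : g ≫ N.out X = c ≫ T.map (S.map (𝟙 X) (H.map g))) : g = N.unfold c := by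
  let g' : (⟨A, c⟩ : Endofunctor.Coalgebra (resFunctor T S H X)) ⟶ N.coalg X :=
    { f := g, h := h.symm }
  exact congrArg Endofunctor.Coalgebra.Hom.f ((N.isTerminal X).hom_ext g' ((N.isTerminal X).from _))

/-- The unit `inl ; η ; out⁻¹` of `T_H`. -/
def unit (X : V) : X ⟶ N.carrier X :=
  S.inl X (H.obj (N.carrier X)) ≫ eta T _ ≫ N.outInv X

/-- The coalgebra on `T_H X ⊕ T_H Y` that runs the left summand, continues with `f` when it
terminates, and runs the right summand. -/
def liftCoalg {X Y : V} (f : X ⟶ N.carrier Y) :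
    S.sum (N.carrier X) (N.carrier Y) ⟶
      T.obj (S.sum Y (H.obj (S.sum (N.carrier X) (N.carrier Y)))) :=
  S.desc
    (N.out X ≫ klift T (S.desc
      (f ≫ N.out Y ≫ T.map (S.map (𝟙 Y) (H.map (S.inr _ _))))
      (H.map (S.inl _ _) ≫ S.inr _ _ ≫ eta T _)))
    (N.out Y ≫ T.map (S.map (𝟙 Y) (H.map (S.inr _ _))))

/-- The Kleisli lifting of `T_H`; see `lift_out` and `lift_unique` for its characterization. -/
def lift {X Y : V} (f : X ⟶ N.carrier Y) : N.carrier X ⟶ N.carrier Y :=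
  S.inl _ _ ≫ N.unfold (N.liftCoalg f)

theorem map_id_map {X A B C : V} (f : A ⟶ B) (g : B ⟶ C) :
    T.map (S.map (𝟙 X) (H.map f)) ≫ T.map (S.map (𝟙 X) (H.map g)) =
      T.map (S.map (𝟙 X) (H.map (f ≫ g))) :=
  ((resFunctor T S H X).map_comp f g).symm

theorem inr_unfold {X Y : V} (f : X ⟶ N.carrier Y) :
    S.inr _ _ ≫ N.unfold (N.liftCoalg f) = 𝟙 (N.carrier Y) := by
  rw [N.unfold_unique (N.out Y) (𝟙 _), N.unfold_unique (N.out Y) (S.inr _ _ ≫ _)]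
  · rw [Category.assoc, unfold_out, liftCoalg, S.inr_desc_assoc, Category.assoc, map_id_map]
  · have := (resFunctor T S H Y).map_id (N.carrier Y)
    change T.map (S.map (𝟙 Y) (H.map (𝟙 _))) = 𝟙 _ at this
    rw [this]; simp

/-- `f⋆ ; out = out ; [f ; out, H f⋆ ; inr ; η]⋆`. -/
theorem lift_out {X Y : V} (f : X ⟶ N.carrier Y) :
    N.lift f ≫ N.out Y =
      N.out X ≫ klift T (S.desc (f ≫ N.out Y) (H.map (N.lift f) ≫ S.inr _ _ ≫ eta T _)) := by
  have e := (resFunctor T S H Y).map_id (N.carrier Y)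
  change T.map (S.map (𝟙 Y) (H.map (𝟙 _))) = 𝟙 _ at e
  have h₁ := N.inr_unfold f
  have h₂ := N.unfold_out (N.liftCoalg f)
  rw [lift]
  generalize N.unfold (N.liftCoalg f) = h at h₁ h₂ ⊢
  rw [Category.assoc, h₂, liftCoalg, S.inl_desc_assoc, Category.assoc, klift_map, S.desc_comp]
  congr 3
  · rw [Category.assoc, Category.assoc, map_id_map, h₁, e, Category.comp_id]
  · simp only [Category.assoc]
    rw [← eta_naturality, S.inr_map_assoc, ← H.map_comp_assoc]

theorem lift_unique {X Y : V} (f : X ⟶ N.carrier Y) (g : N.carrier X ⟶ N.carrier Y)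
    (h : g ≫ N.out Y =
      N.out X ≫ klift T (S.desc (f ≫ N.out Y) (H.map g ≫ S.inr _ _ ≫ eta T _))) :
    g = N.lift f := by
  have e := (resFunctor T S H Y).map_id (N.carrier Y)
  change T.map (S.map (𝟙 Y) (H.map (𝟙 _))) = 𝟙 _ at e
  rw [lift, ← N.unfold_unique (N.liftCoalg f) (S.desc g (𝟙 _)), S.inl_desc]
  rw [liftCoalg, S.desc_comp, S.desc_comp]
  congr 1
  · rw [h, Category.assoc, klift_map, S.desc_comp]
    congr 3
    · rw [Category.assoc, Category.assoc, map_id_map, S.inr_desc, e, Category.comp_id]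
    · simp only [Category.assoc]
      rw [← eta_naturality, S.inr_map_assoc, ← H.map_comp_assoc, S.inl_desc]
  · rw [Category.assoc, map_id_map, S.inr_desc, e, Category.comp_id, Category.id_comp]

theorem lift_unit (X : V) : N.lift (N.unit X) = 𝟙 _ := by
  symm
  apply N.lift_unique
  have : S.desc (N.unit X ≫ N.out X) (H.map (𝟙 (N.carrier X)) ≫ S.inr _ _ ≫ eta T _) =
      eta T (S.sum X (H.obj (N.carrier X))) := by
    apply S.hom_ext <;> simp [unit]
  rw [this]; simp

theorem unit_lift {X Y : V} (f : X ⟶ N.carrier Y) : N.unit X ≫ N.lift f = f := by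
  apply N.cancel_out
  rw [Category.assoc, lift_out]
  simp [unit]

theorem lift_lift {X Y Z : V} (g : X ⟶ N.carrier Y) (f : Y ⟶ N.carrier Z) :
    N.lift g ≫ N.lift f = N.lift (g ≫ N.lift f) := by
  apply N.lift_unique
  rw [Category.assoc, lift_out, ← Category.assoc, lift_out, Category.assoc, klift_klift,
    S.desc_comp]
  congr 3
  · rw [Category.assoc, Category.assoc, lift_out]
  · simp

/-- The generalized coalgebraic resumption monad `T_H`, `T_H X = ν γ. T (X ⊕ H γ)`. -/
def monad : Monad V :=
  monadOfTriple N.carrier N.unit (fun f => N.lift f) N.lift_unit (fun f => N.unit_lift f)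
    (fun g f => N.lift_lift g f)

/-- The Kleisli lifting `f⋆ : T_H X ⟶ T_H Y` of a morphism of the Kleisli category of `T_H`. -/
def liftHom {X Y : Kleisli N.monad} (f : X ⟶ Y) : N.carrier X.of ⟶ N.carrier Y.of :=
  N.lift (X := X.of) (Y := Y.of) f.of

theorem liftHom_eq_klift {X Y : Kleisli N.monad} (f : X ⟶ Y) :
    N.liftHom f = klift N.monad f.of := by
  let g : X.of ⟶ N.carrier Y.of := f.of
  change N.lift g = N.lift (g ≫ N.unit _) ≫ N.lift (𝟙 _)
  rw [N.lift_lift, Category.assoc, N.unit_lift, Category.comp_id]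

/-- `p ; out` for a morphism `p : X ⟶ Y` of the Kleisli category of `T_H`, as a morphism
`X ⟶ Y ⊕ H (T_H Y)` of the Kleisli category of `T`. -/
def compOut {X Y : Kleisli N.monad} (p : X ⟶ Y) :
    Kleisli.mk T X.of ⟶ Kleisli.mk T (S.sum Y.of (H.obj (N.carrier Y.of))) :=
  ⟨(show X.of ⟶ N.carrier Y.of from p.of) ≫ N.out Y.of⟩

/-- `q ; out⁻¹` for a morphism `q : X ⟶ Y ⊕ H (T_H Y)` of the Kleisli category of `T`. -/
def compOutInv {X Y : Kleisli N.monad}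
    (q : Kleisli.mk T X.of ⟶ Kleisli.mk T (S.sum Y.of (H.obj (N.carrier Y.of)))) : X ⟶ Y :=
  ⟨show X.of ⟶ N.carrier Y.of from q.of ≫ N.outInv Y.of⟩

/-- The inclusion of the Kleisli category of `T` into that of `T_H`: the identity on objects,
and `f ↦ f ; T inl ; out⁻¹` on morphisms. -/
def inclusion : Kleisli T ⥤ Kleisli N.monad where
  obj X := Kleisli.mk N.monad X.of
  map {_ Y} f := N.compOutInv (X := Kleisli.mk N.monad _) (Y := Kleisli.mk N.monad _)
    ⟨f.of ≫ T.map (S.inl Y.of (H.obj (N.carrier Y.of)))⟩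
  map_id X := by
    apply Kleisli.hom_ext
    change (eta T X.of ≫ T.map (S.inl _ _)) ≫ N.outInv X.of = N.unit X.of
    rw [← eta_naturality, unit, Category.assoc]
  map_comp {X Y Z} f g := by
    apply Kleisli.hom_ext
    change ((f.of ≫ T.map g.of ≫ T.μ.app Z.of) ≫ T.map (S.inl _ _)) ≫ N.outInv Z.of =
      ((f.of ≫ T.map (S.inl _ _)) ≫ N.outInv Y.of) ≫
        N.lift (((g.of ≫ T.map (S.inl _ _)) ≫ N.outInv Z.of) ≫ N.unit _) ≫ N.lift (𝟙 _)
    rw [N.lift_lift, Category.assoc _ (N.unit _), N.unit_lift, Category.comp_id]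
    apply N.cancel_out
    have := klift_map T g.of (S.inl Z.of (H.obj (N.carrier Z.of)))
    rw [klift] at this
    simp only [Category.assoc] at this
    simp [N.lift_out, map_klift, this]

end FinalCoalgebras

/-- Either all zero endomorphisms are tame (equivalently, the KiC admits a family of tests
consisting of tame morphisms), or all morphisms `f ; η` with `f` from the base category are
tame. -/
def ZeroOrPureTame {T : Monad V} {S : SelectedCoproducts V}
    (K : KiC (Kleisli T) (kleisliCoproducts T S)) : Prop :=
  (∀ X : Kleisli T, K.tame (K.zero X X)) ∨
    ∀ {X Y : V} (f : X ⟶ Y), K.tame ((Kleisli.Adjunction.toKleisli T).map f)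

end Resumptions

end Resumption

/-! A morphism p of the Kleisli category of T_H amounts to its first step `code p` = p;out in the
Kleisli category of T. Composition becomes code (p;q) = code p;[code q, next q;inr] (`code_comp`),
so the grove laws transfer at once. By finality a guarded equation code f = r;(id ⊕ next f) has
exactly one solution (`code_solve`, `eq_solve`). An iteration law therefore follows once both sides
are seen to solve the equation with the same r.

To find that r, the action on continuations must be moved out of an iteration: inl;[q;(id ⊕ h),0]* =
inl;[q,0]*;(id ⊕ h) for h coming from V (`inl_star_naturality`). Here (Z) enters. If pure morphisms
are tame, this is uniformity. If zeros are tame, every h is allowed: h is simulated by an extra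
nilpotent step D on X ⊕ (A ⊕ B), and the two expansions of (P + D)* are compared
(`inl_star_naturality_of_zero_tame`). -/

namespace Resumption

/-! ### Coproduct identities. -/

namespace SelectedCoproducts

variable {C : Type u} [Category.{v} C] (S : SelectedCoproducts C)

theorem map_desc {X Y X' Y' Z : C} (f : X ⟶ X') (g : Y ⟶ Y') (h : X' ⟶ Z) (k : Y' ⟶ Z) :
    S.map f g ≫ S.desc h k = S.desc (f ≫ h) (g ≫ k) :=
  S.hom_ext (by simp) (by simp)

theorem map_map {X Y X' Y' X'' Y'' : C} (f : X ⟶ X') (g : Y ⟶ Y') (h : X' ⟶ X'')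
    (k : Y' ⟶ Y'') : S.map f g ≫ S.map h k = S.map (f ≫ h) (g ≫ k) :=
  S.hom_ext (by simp) (by simp)

theorem desc_inl_inr (X Y : C) : S.desc (S.inl X Y) (S.inr X Y) = 𝟙 _ :=
  S.hom_ext (by simp) (by simp)

end SelectedCoproducts

/-! ### Iterations of the form [q,0]* in an arbitrary KiC. -/

namespace KiC

variable {C : Type u} [Category.{v} C] {S : SelectedCoproducts C} (K : KiC C S)

theorem add_zero {X Y : C} (p : X ⟶ Y) : K.add p (K.zero X Y) = p := by
  rw [K.add_comm, K.zero_add]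

theorem desc_add {X Y Z : C} (a b : X ⟶ Z) (c d : Y ⟶ Z) :
    S.desc (K.add a b) (K.add c d) = K.add (S.desc a c) (S.desc b d) := by
  apply S.hom_ext
  · rw [(K.inl_linear X Y).2]; simp
  · rw [(K.inr_linear X Y).2]; simp

theorem desc_add_zero {X Y Z : C} (a b : X ⟶ Z) :
    S.desc (K.add a b) (K.zero Y Z) = K.add (S.desc a (K.zero Y Z)) (S.desc b (K.zero Y Z)) := by
  rw [← desc_add, K.add_self]

theorem tame_map {X Y X' Y' : C} (f : X ⟶ X') (g : Y ⟶ Y') (hf : K.tame f) (hg : K.tame g) :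
    K.tame (S.map f g) :=
  K.tame_desc _ _ (K.tame_comp _ _ hf (K.tame_inl _ _)) (K.tame_comp _ _ hg (K.tame_inr _ _))

/-- A linear morphism that is annihilated by `p` is not affected by the iteration of `p`. -/
theorem comp_star_of_comp_eq_zero {X Y : C} (u : X ⟶ Y) (p : Y ⟶ Y)
    (hu : K.toIdempotentGrove.IsLinear u) (h : u ≫ p = K.zero X Y) : u ≫ K.star p = u := by
  rw [K.star_fix, hu.2, ← Category.assoc, h, K.zero_comp, K.add_zero, Category.comp_id]

/-- The zero branch offers no step from A, so only the identity summand of the iteration survives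
there. -/
theorem inr_star {X A : C} (q : X ⟶ S.sum X A) :
    S.inr X A ≫ K.star (S.desc q (K.zero _ _)) = S.inr X A :=
  K.comp_star_of_comp_eq_zero _ _ (K.inr_linear X A) (S.inr_desc _ _)

/-- Uniformity of `q ↦ [q, 0]*` along tame morphisms. -/
theorem map_star {X Y A B : C} (g : X ⟶ Y) (h : A ⟶ B) (hg : K.tame g) (hh : K.tame h)
    (q : X ⟶ S.sum X A) (p : Y ⟶ S.sum Y B) (e : g ≫ p = q ≫ S.map g h) :
    S.map g h ≫ K.star (S.desc p (K.zero _ _)) =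
      K.star (S.desc q (K.zero _ _)) ≫ S.map g h := by
  apply K.star_uni _ _ _ (K.tame_map _ _ hg hh)
  rw [S.map_desc, S.desc_comp, (K.tame_linear h hh).1, K.zero_comp, e]

theorem inl_star_of_tame {X Y A B : C} (g : X ⟶ Y) (h : A ⟶ B) (hg : K.tame g) (hh : K.tame h)
    (q : X ⟶ S.sum X A) (p : Y ⟶ S.sum Y B) (e : g ≫ p = q ≫ S.map g h) :
    g ≫ S.inl Y B ≫ K.star (S.desc p (K.zero _ _)) =
      S.inl X A ≫ K.star (S.desc q (K.zero _ _)) ≫ S.map g h := by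
  rw [← K.map_star g h hg hh q p e, S.inl_map_assoc]

/-- If the zero endomorphisms are tame, `q ↦ inl ; [q, 0]*` is natural in the parameter. -/
theorem inl_star_naturality_of_zero_tame (hZ : ∀ X : C, K.tame (K.zero X X)) {X A B : C}
    (q : X ⟶ S.sum X A) (h : A ⟶ B) :
    S.inl X B ≫ K.star (S.desc (q ≫ S.map (𝟙 X) h) (K.zero _ _)) =
      S.inl X A ≫ K.star (S.desc q (K.zero _ _)) ≫ S.map (𝟙 X) h := by
  -- Both parameters are kept side by side: P exits into A, D performs h as a step from A to B, M
  -- exits by either route, and z discards the A-part.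
  let ι : A ⟶ S.sum A B := S.inl A B
  let κ : B ⟶ S.sum A B := S.inr A B
  let P : S.sum X (S.sum A B) ⟶ S.sum X (S.sum A B) := S.desc (q ≫ S.map (𝟙 X) ι) (K.zero _ _)
  let n : S.sum A B ⟶ S.sum X (S.sum A B) := S.desc (h ≫ κ ≫ S.inr X _) (K.zero _ _)
  let D : S.sum X (S.sum A B) ⟶ S.sum X (S.sum A B) := S.desc (K.zero _ _) n
  let z : S.sum A B ⟶ S.sum A B := S.desc (K.zero _ _) κ
  let M : S.sum X (S.sum A B) ⟶ S.sum X (S.sum A B) := S.desc (q ≫ S.map (𝟙 X) (K.add ι (h ≫ κ))) (K.zero _ _)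
  have hz : K.tame z := by
    refine K.tame_desc _ _ ?_ (K.tame_inr _ _)
    -- Only zero endomorphisms are assumed tame, so the zero into A ⊕ B is factored through A.
    rw [← K.zero_comp A (S.inl A B)]
    exact K.tame_comp _ _ (hZ A) (K.tame_inl _ _)
  -- D lands in B, where it vanishes; hence D;D = 0 and D* stops at id + D.
  have hκD : κ ≫ S.inr X _ ≫ D = K.zero _ _ := by simp [D, n, κ]
  have hstarD : K.star D = K.add (𝟙 _) D := by
    rw [K.star_fix]
    congr 1
    have h₁ : κ ≫ S.inr X _ ≫ K.star D = κ ≫ S.inr X _ := by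
      rw [← Category.assoc]
      apply K.comp_star_of_comp_eq_zero
      · exact K.tame_linear _ (K.tame_comp _ _ (K.tame_inr _ _) (K.tame_inr _ _))
      · rw [Category.assoc, hκD]
    rw [S.desc_comp, K.zero_comp, S.desc_comp, K.zero_comp, Category.assoc, Category.assoc, h₁]
  have hDP : D ≫ K.star P = D := by
    rw [S.desc_comp, K.zero_comp, S.desc_comp, K.zero_comp, Category.assoc, Category.assoc,
      K.inr_star]
  have hιD : S.map (𝟙 X) ι ≫ K.add (𝟙 _) D = S.map (𝟙 X) (K.add ι (h ≫ κ)) := by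
    have hl := K.tame_linear _ (K.tame_map (𝟙 X) ι (K.tame_id X) (K.tame_inl A B))
    rw [hl.2]
    apply S.hom_ext
    · rw [(K.inl_linear _ _).2]
      simp [D, K.add_zero]
    · rw [(K.inr_linear _ _).2]
      simp [D, n, ι, K.add_comp]
  have hPD : P ≫ K.star D = M := by
    rw [hstarD, S.desc_comp, K.zero_comp, Category.assoc, hιD]
  -- The two orders of summands expand (P + D)* in two ways; D;P* = D simplifies one and P;D* = M
  -- the other.
  have h₁ : K.star P ≫ K.star D = K.star D ≫ K.star M := by
    have := K.star_sum P D
    rw [hDP, K.add_comm, K.star_sum, hPD] at this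
    exact this.symm
  have h₂ : S.inl X _ ≫ K.star M = S.inl X _ ≫ K.star P ≫ K.star D := by
    rw [h₁, hstarD, ← Category.assoc, (K.inl_linear _ _).2]
    simp [D, K.add_zero]
  have h₃ := K.inl_star_of_tame (𝟙 X) ι (K.tame_id X) (K.tame_inl A B) q
    (q ≫ S.map (𝟙 X) ι) (Category.id_comp _)
  rw [Category.id_comp] at h₃
  -- Postcomposition with z turns ι + h;κ into h;κ. Tameness is needed of z only, never of h.
  have h₄ := K.inl_star_of_tame (𝟙 X) z (K.tame_id X) hz
    (q ≫ S.map (𝟙 X) (K.add ι (h ≫ κ))) (q ≫ S.map (𝟙 X) (h ≫ κ)) (by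
      rw [Category.id_comp, Category.assoc, S.map_map, K.add_comp, Category.id_comp]
      simp [ι, κ, z, K.zero_add])
  have h₅ := K.inl_star_of_tame (𝟙 X) κ (K.tame_id X) (K.tame_inr A B)
    (q ≫ S.map (𝟙 X) h) (q ≫ S.map (𝟙 X) (h ≫ κ)) (by
      rw [Category.id_comp, Category.assoc, S.map_map, Category.id_comp])
  rw [Category.id_comp] at h₄ h₅
  have h₆ : S.inl X B ≫ K.star (S.desc (q ≫ S.map (𝟙 X) h) (K.zero _ _)) ≫ S.map (𝟙 X) κ =
      S.inl X A ≫ K.star (S.desc q (K.zero _ _)) ≫ S.map (𝟙 X) h ≫ S.map (𝟙 X) κ := by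
    rw [← h₅, h₄]
    change S.inl X _ ≫ K.star M ≫ _ = _
    rw [← Category.assoc, h₂, hstarD, ← Category.assoc (S.inl X _), h₃]
    simp only [Category.assoc]
    rw [← Category.assoc (S.map (𝟙 X) ι), hιD, S.map_map, S.map_map, K.add_comp]
    simp [ι, κ, z, K.zero_add]
  -- The map id ⊕ κ is cancelled by its retraction [inl,[0,inr]].
  have h₇ := congrArg (· ≫ S.desc (S.inl X B) (S.desc (K.zero A _) (S.inr X B))) h₆
  simp only [Category.assoc] at h₇
  rw [S.map_desc, S.inr_desc, Category.id_comp, S.desc_inl_inr, Category.comp_id,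
    Category.comp_id] at h₇
  exact h₇

end KiC

/-! ### Pure morphisms in a Kleisli category. -/

section KleisliHoms

variable {V : Type u} [Category.{v} V]

/-- A morphism of the base category, as a morphism of the Kleisli category. -/
def pureHom (T : Monad V) {X Y : V} (f : X ⟶ Y) : Kleisli.mk T X ⟶ Kleisli.mk T Y :=
  ⟨f ≫ eta T Y⟩

theorem kleisli_comp_of {T : Monad V} {X Y Z : Kleisli T} (f : X ⟶ Y) (g : Y ⟶ Z) :
    (f ≫ g).of = f.of ≫ klift T g.of := rfl

theorem pureHom_comp (T : Monad V) {X Y Z : V} (f : X ⟶ Y) (g : Y ⟶ Z) :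
    pureHom T (f ≫ g) = pureHom T f ≫ pureHom T g :=
  (Kleisli.Adjunction.toKleisli T).map_comp f g

theorem pureHom_id (T : Monad V) (X : V) : pureHom T (𝟙 X) = 𝟙 _ :=
  (Kleisli.Adjunction.toKleisli T).map_id X

theorem comp_pureHom_of {T : Monad V} {X : Kleisli T} {Y Z : V} (f : X ⟶ Kleisli.mk T Y)
    (g : Y ⟶ Z) : (f ≫ pureHom T g).of = f.of ≫ T.map g := by
  rw [kleisli_comp_of, pureHom, ← map_klift, klift_unit, Category.comp_id]

theorem kleisliCoproducts_map_pureHom (T : Monad V) (S : SelectedCoproducts V) {X Y X' Y' : V}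
    (f : X ⟶ X') (g : Y ⟶ Y') :
    (kleisliCoproducts T S).map (pureHom T f) (pureHom T g) = pureHom T (S.map f g) := by
  apply (kleisliCoproducts T S).hom_ext
  · rw [SelectedCoproducts.inl_map]
    change pureHom T f ≫ pureHom T (S.inl X' Y') = pureHom T (S.inl X Y) ≫ pureHom T (S.map f g)
    rw [← pureHom_comp, ← pureHom_comp, S.inl_map]
  · rw [SelectedCoproducts.inr_map]
    change pureHom T g ≫ pureHom T (S.inr X' Y') = pureHom T (S.inr X Y) ≫ pureHom T (S.map f g)
    rw [← pureHom_comp, ← pureHom_comp, S.inr_map]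

end KleisliHoms

/-! ### First steps and guarded equations. -/

namespace FinalCoalgebras

variable {V : Type u} [Category.{v} V] {T : Monad V} {S : SelectedCoproducts V} {H : V ⥤ V}
  (N : FinalCoalgebras T S H)

/-- The object `X` of the Kleisli category of `T_H`, in the Kleisli category of `T`. -/
abbrev base (X : Kleisli N.monad) : Kleisli T := Kleisli.mk T X.of

/-- The object `H T_H X` of the Kleisli category of `T`. -/
abbrev cont (X : Kleisli N.monad) : Kleisli T := Kleisli.mk T (H.obj (N.carrier X.of))

/-- The first step `p ; out` of `p`, with values in the coproduct of the Kleisli category. -/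
def code {X Y : Kleisli N.monad} (p : X ⟶ Y) :
    N.base X ⟶ (kleisliCoproducts T S).sum (N.base Y) (N.cont Y) := N.compOut p

/-- The morphism with the given first step. -/
def decode {X Y : Kleisli N.monad}
    (q : N.base X ⟶ (kleisliCoproducts T S).sum (N.base Y) (N.cont Y)) : X ⟶ Y := N.compOutInv q

/-- The action of `p⋆` on the continuations. -/
def next {X Y : Kleisli N.monad} (p : X ⟶ Y) : N.cont X ⟶ N.cont Y :=
  pureHom T (H.map (N.liftHom p))

theorem code_decode {X Y : Kleisli N.monad}
    (q : N.base X ⟶ (kleisliCoproducts T S).sum (N.base Y) (N.cont Y)) :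
    N.code (N.decode q) = q := by
  apply Kleisli.hom_ext
  let q' : X.of ⟶ T.obj (S.sum Y.of (H.obj (N.carrier Y.of))) := q.of
  change (q' ≫ N.outInv Y.of) ≫ N.out Y.of = q'
  simp

theorem code_injective {X Y : Kleisli N.monad} {p q : X ⟶ Y} (h : N.code p = N.code q) :
    p = q := by
  apply Kleisli.hom_ext
  exact N.cancel_out (f := p.of) (g := q.of) (congrArg Kleisli.Hom.of h)

theorem liftHom_comp {X Y Z : Kleisli N.monad} (p : X ⟶ Y) (q : Y ⟶ Z) :
    N.liftHom (p ≫ q) = N.liftHom p ≫ N.liftHom q := by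
  simp only [liftHom_eq_klift]
  rw [kleisli_comp_of]
  exact (klift_klift N.monad p.of q.of).symm

theorem next_comp {X Y Z : Kleisli N.monad} (p : X ⟶ Y) (q : Y ⟶ Z) :
    N.next (p ≫ q) = N.next p ≫ N.next q := by
  rw [next, liftHom_comp, H.map_comp, pureHom_comp]; rfl

/-- This is the defining equation of the lifting of T_H read in the Kleisli category of T:
terminating runs of p continue with q, suspended ones are postprocessed by q. -/
theorem code_comp {X Y Z : Kleisli N.monad} (p : X ⟶ Y) (q : Y ⟶ Z) :
    N.code (p ≫ q) = N.code p ≫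
      (kleisliCoproducts T S).desc (N.code q) (N.next q ≫ (kleisliCoproducts T S).inr _ _) := by
  have h : N.next q ≫ (kleisliCoproducts T S).inr (N.base Z) (N.cont Z) =
      ⟨H.map (N.liftHom q) ≫ S.inr Z.of (H.obj (N.carrier Z.of)) ≫ eta T _⟩ := by
    change pureHom T _ ≫ pureHom T (S.inr _ _) = _
    rw [← pureHom_comp, pureHom, Category.assoc]
    rfl
  rw [h]
  apply Kleisli.hom_ext
  have h' : (p ≫ q).of = p.of ≫ N.liftHom q := by
    rw [liftHom_eq_klift, kleisli_comp_of]; rfl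
  let p' : X.of ⟶ N.carrier Y.of := p.of
  let q' : Y.of ⟶ N.carrier Z.of := q.of
  change (p ≫ q).of ≫ N.out Z.of = (p' ≫ N.out Y.of) ≫ klift T (S.desc (q' ≫ N.out Z.of) _)
  rw [h']
  change (p' ≫ N.lift q') ≫ N.out Z.of = _
  rw [Category.assoc, lift_out, Category.assoc]
  rfl

theorem code_id (X : Kleisli N.monad) :
    N.code (𝟙 X) = (kleisliCoproducts T S).inl (N.base X) (N.cont X) := by
  apply Kleisli.hom_ext
  change N.unit X.of ≫ N.out X.of = S.inl _ _ ≫ eta T _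
  simp [unit]

theorem code_inclusion_map {X Y : Kleisli T} (g : X ⟶ Y) :
    N.code (N.inclusion.map g) = g ≫ (kleisliCoproducts T S).inl Y (N.cont (N.inclusion.obj Y)) := by
  refine (N.code_decode _).trans ?_
  apply Kleisli.hom_ext
  exact (comp_pureHom_of g (S.inl Y.of (H.obj (N.carrier Y.of)))).symm

/-- The unfolding of a guarded first step `r`: the solution `f` of
`f ; out = r ; (id ⊕ H f⋆)`. -/
def solve {X Y : Kleisli N.monad}
    (r : N.base X ⟶ (kleisliCoproducts T S).sum (N.base Y) (N.cont X)) : X ⟶ Y :=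
  ⟨show X.of ⟶ N.carrier Y.of from
    N.unit X.of ≫ N.unfold (N.out X.of ≫ klift T (S.desc r.of (S.inr _ _ ≫ eta T _)))⟩

theorem comp_map_next_of {X Y Z : Kleisli N.monad} {W : Kleisli T}
    (r : W ⟶ (kleisliCoproducts T S).sum (N.base Z) (N.cont X)) (f : X ⟶ Y) :
    (r ≫ (kleisliCoproducts T S).map (𝟙 (N.base Z)) (N.next f)).of =
      r.of ≫ T.map (S.map (𝟙 Z.of) (H.map (N.liftHom f))) := by
  have h := kleisliCoproducts_map_pureHom T S (𝟙 Z.of) (H.map (N.liftHom f))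
  rw [pureHom_id] at h
  rw [next, h]
  exact comp_pureHom_of (Y := S.sum Z.of (H.obj (N.carrier X.of))) r _

/-- The guarded equation makes the lifting of f a coalgebra morphism from out;[r, inr;η]⋆ to the
final coalgebra; f is recovered by precomposing with the unit. -/
theorem eq_solve {X Y : Kleisli N.monad}
    (r : N.base X ⟶ (kleisliCoproducts T S).sum (N.base Y) (N.cont X)) (f : X ⟶ Y)
    (h : N.code f = r ≫ (kleisliCoproducts T S).map (𝟙 (N.base Y)) (N.next f)) :
    f = N.solve r := by
  have h' := congrArg Kleisli.Hom.of h
  rw [comp_map_next_of] at h'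
  let f' : X.of ⟶ N.carrier Y.of := f.of
  let r' : X.of ⟶ T.obj (S.sum Y.of (H.obj (N.carrier X.of))) := r.of
  change f' ≫ N.out Y.of = r' ≫ T.map (S.map (𝟙 Y.of) (H.map (N.lift f'))) at h'
  have hf : N.lift f' = N.unfold (N.out X.of ≫ klift T (S.desc r' (S.inr _ _ ≫ eta T _))) := by
    apply N.unfold_unique
    rw [lift_out, Category.assoc, klift_map, S.desc_comp, h', Category.assoc (S.inr _ _),
      ← eta_naturality, S.inr_map_assoc]
  apply Kleisli.hom_ext
  change f' = N.unit X.of ≫ N.unfold (N.out X.of ≫ klift T (S.desc r' (S.inr _ _ ≫ eta T _)))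
  rw [← hf, unit_lift]

theorem code_solve {X Y : Kleisli N.monad}
    (r : N.base X ⟶ (kleisliCoproducts T S).sum (N.base Y) (N.cont X)) :
    N.code (N.solve r) = r ≫ (kleisliCoproducts T S).map (𝟙 (N.base Y)) (N.next (N.solve r)) := by
  apply Kleisli.hom_ext
  rw [comp_map_next_of]
  let r' : X.of ⟶ T.obj (S.sum Y.of (H.obj (N.carrier X.of))) := r.of
  let c := N.out X.of ≫ klift T (S.desc r' (S.inr _ _ ≫ eta T _))
  have hc := N.unfold_out c
  have hu : (N.unit X.of ≫ N.unfold c) ≫ N.out Y.of =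
      r' ≫ T.map (S.map (𝟙 Y.of) (H.map (N.unfold c))) := by
    rw [Category.assoc, hc]
    simp [c, unit]
  -- The equation involves the lifting of the solution rather than the unfolding; they agree by
  -- uniqueness of liftings.
  have hl : N.lift (N.unit X.of ≫ N.unfold c) = N.unfold c := by
    symm
    apply N.lift_unique
    rw [hc, hu, Category.assoc, klift_map, S.desc_comp, Category.assoc (S.inr _ _),
      ← eta_naturality, S.inr_map_assoc]
  change (N.unit X.of ≫ N.unfold c) ≫ N.out Y.of = r' ≫
    T.map (S.map (𝟙 Y.of) (H.map (N.lift (N.unit X.of ≫ N.unfold c))))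
  rw [hl, hu]

end FinalCoalgebras

/-! ### Naturality in the parameter under (Z). -/

/-- Pure h suffice, because `next` is pure by definition. The KiC laws for T_H depend on (Z) through
this lemma alone. -/
theorem inl_star_naturality {V : Type u} [Category.{v} V] {T : Monad V}
    {S : SelectedCoproducts V} (K : KiC (Kleisli T) (kleisliCoproducts T S))
    (hK : ZeroOrPureTame K) {X : Kleisli T} {A B : V}
    (q : X ⟶ (kleisliCoproducts T S).sum X (Kleisli.mk T A)) (h : A ⟶ B) :
    (kleisliCoproducts T S).inl X _ ≫ K.star ((kleisliCoproducts T S).desc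
        (q ≫ (kleisliCoproducts T S).map (𝟙 X) (pureHom T h)) (K.zero _ _)) =
      (kleisliCoproducts T S).inl X _ ≫ K.star ((kleisliCoproducts T S).desc q (K.zero _ _)) ≫
        (kleisliCoproducts T S).map (𝟙 X) (pureHom T h) := by
  rcases hK with hZ | hP
  · exact K.inl_star_naturality_of_zero_tame hZ q (pureHom T h)
  · have := K.inl_star_of_tame (𝟙 X) (pureHom T h) (K.tame_id X) (hP h) q _ (Category.id_comp _)
    rwa [Category.id_comp] at this

/-! ### The inclusion of the Kleisli category of T. -/

namespace FinalCoalgebras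

variable {V : Type u} [Category.{v} V] {T : Monad V} {S : SelectedCoproducts V} {H : V ⥤ V}
  (N : FinalCoalgebras T S H)

theorem inclusion_faithful (K : KiC (Kleisli T) (kleisliCoproducts T S)) :
    N.inclusion.Faithful where
  map_injective {X Y f g} h := by
    -- The injection inl has the retraction [id,0], so the first step of an included morphism
    -- determines it.
    have h' := congrArg (fun k => N.code k ≫
      (kleisliCoproducts T S).desc (𝟙 (N.base (N.inclusion.obj Y))) (K.zero _ _)) h
    simp only [code_inclusion_map] at h'
    have e : (kleisliCoproducts T S).inl Y (N.cont (N.inclusion.obj Y)) ≫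
        (kleisliCoproducts T S).desc (𝟙 Y) (K.zero _ _) = 𝟙 Y := SelectedCoproducts.inl_desc _ _ _
    have e' (k : X ⟶ Y) : k ≫ (kleisliCoproducts T S).inl Y (N.cont (N.inclusion.obj Y)) ≫
        (kleisliCoproducts T S).desc (𝟙 Y) (K.zero _ _) = k := by rw [e, Category.comp_id]
    exact (e' f).symm.trans ((Category.assoc _ _ _).symm.trans
      (h'.trans ((Category.assoc _ _ _).trans (e' g))))

theorem inclusion_obj_bijective : Function.Bijective N.inclusion.obj :=
  ⟨fun _ _ h => congrArg (fun Z : Kleisli N.monad => Kleisli.mk T Z.of) h,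
    fun X => ⟨Kleisli.mk T X.of, rfl⟩⟩

/-- A morphism of the Kleisli category of `T`, in the Kleisli category of `T_H`. -/
def incl {X Y : Kleisli N.monad} (g : N.base X ⟶ N.base Y) : X ⟶ Y := N.inclusion.map g

theorem code_incl {X Y : Kleisli N.monad} (g : N.base X ⟶ N.base Y) :
    N.code (N.incl g) = g ≫ (kleisliCoproducts T S).inl (N.base Y) (N.cont Y) :=
  N.code_inclusion_map g

theorem code_incl_comp {X Y Z : Kleisli N.monad} (g : N.base X ⟶ N.base Y) (p : Y ⟶ Z) :
    N.code (N.incl g ≫ p) = g ≫ N.code p := by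
  rw [code_comp, code_incl, Category.assoc, SelectedCoproducts.inl_desc]

/-- The continuations are changed as well, by a pure map not known to be tame even if g is. This is
why uniformity for T_H needs naturality too. -/
theorem code_comp_incl {X Y Z : Kleisli N.monad} (p : X ⟶ Y) (g : N.base Y ⟶ N.base Z) :
    N.code (p ≫ N.incl g) = N.code p ≫ (kleisliCoproducts T S).map g (N.next (N.incl g)) := by
  rw [code_comp, code_incl]
  rfl

theorem incl_id (X : Kleisli N.monad) : N.incl (𝟙 (N.base X)) = 𝟙 X :=
  N.inclusion.map_id (N.base X)

theorem incl_comp {X Y Z : Kleisli N.monad} (f : N.base X ⟶ N.base Y) (g : N.base Y ⟶ N.base Z) :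
    N.incl (f ≫ g) = N.incl f ≫ N.incl g :=
  N.inclusion.map_comp f g

theorem incl_pureHom {X Y : V} (f : X ⟶ Y) :
    N.incl (X := Kleisli.mk _ X) (Y := Kleisli.mk _ Y) (pureHom T f) = pureHom N.monad f := by
  apply N.code_injective
  rw [code_incl]
  apply Kleisli.hom_ext
  change (f ≫ eta T Y) ≫ klift T (S.inl _ _ ≫ eta T _) = (f ≫ N.unit Y) ≫ N.out Y
  simp [unit]

theorem incl_inl (X Y : Kleisli N.monad) :
    N.incl (Y := (kleisliCoproducts N.monad S).sum X Y)
      ((kleisliCoproducts T S).inl (N.base X) (N.base Y)) =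
      (kleisliCoproducts N.monad S).inl X Y :=
  N.incl_pureHom (S.inl X.of Y.of)

theorem incl_inr (X Y : Kleisli N.monad) :
    N.incl (Y := (kleisliCoproducts N.monad S).sum X Y)
      ((kleisliCoproducts T S).inr (N.base X) (N.base Y)) =
      (kleisliCoproducts N.monad S).inr X Y :=
  N.incl_pureHom (S.inr X.of Y.of)

theorem incl_desc {X Y Z : Kleisli N.monad} (f : N.base X ⟶ N.base Z) (g : N.base Y ⟶ N.base Z) :
    N.incl (X := (kleisliCoproducts N.monad S).sum X Y) ((kleisliCoproducts T S).desc f g) =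
      (kleisliCoproducts N.monad S).desc (N.incl f) (N.incl g) := by
  apply (kleisliCoproducts N.monad S).hom_ext
  · rw [SelectedCoproducts.inl_desc, ← incl_inl]
    refine (N.incl_comp (Y := (kleisliCoproducts N.monad S).sum X Y) _ _).symm.trans ?_
    exact congrArg N.incl (SelectedCoproducts.inl_desc _ _ _)
  · rw [SelectedCoproducts.inr_desc, ← incl_inr]
    refine (N.incl_comp (Y := (kleisliCoproducts N.monad S).sum X Y) _ _).symm.trans ?_
    exact congrArg N.incl (SelectedCoproducts.inr_desc _ _ _)

/-- Two morphisms with the same guarded first step are equal. -/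
theorem eq_of_code_eq {X Y : Kleisli N.monad}
    (r : N.base X ⟶ (kleisliCoproducts T S).sum (N.base Y) (N.cont X)) {f g : X ⟶ Y}
    (hf : N.code f = r ≫ (kleisliCoproducts T S).map (𝟙 (N.base Y)) (N.next f))
    (hg : N.code g = r ≫ (kleisliCoproducts T S).map (𝟙 (N.base Y)) (N.next g)) : f = g :=
  (N.eq_solve r f hf).trans (N.eq_solve r g hg).symm

/-! ### Grove structure and iteration for T_H. -/

variable (K : KiC (Kleisli T) (kleisliCoproducts T S))

/-- The idempotent grove structure on the Kleisli category of `T_H`. -/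
def grove : IdempotentGrove (Kleisli N.monad) where
  zero X Y := N.decode (K.zero _ _)
  add p q := N.decode (K.add (N.code p) (N.code q))
  zero_add p := N.code_injective (by simp only [code_decode, K.zero_add])
  add_self p := N.code_injective (by simp only [code_decode, K.add_self])
  add_comm p q := N.code_injective (by simp only [code_decode]; rw [K.add_comm])
  add_assoc p q r := N.code_injective (by simp only [code_decode, K.add_assoc])
  zero_comp X Y Z p := N.code_injective (by simp only [code_comp, code_decode, K.zero_comp])
  add_comp q r p := N.code_injective (by simp only [code_comp, code_decode, K.add_comp])

theorem code_add {X Y : Kleisli N.monad} (p q : X ⟶ Y) :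
    N.code ((N.grove K).add p q) = K.add (N.code p) (N.code q) := N.code_decode _

theorem code_zero (X Y : Kleisli N.monad) : N.code ((N.grove K).zero X Y) = K.zero _ _ :=
  N.code_decode _

theorem incl_zero (X Y : Kleisli N.monad) : N.incl (K.zero _ _) = (N.grove K).zero X Y := by
  apply N.code_injective
  rw [code_incl, code_zero, K.zero_comp]

theorem incl_linear {X Y : Kleisli N.monad} (g : N.base X ⟶ N.base Y)
    (hg : K.toIdempotentGrove.IsLinear g) : (N.grove K).IsLinear (N.incl g) := by
  constructor
  · intro Z
    apply N.code_injective
    rw [code_incl_comp, code_zero, code_zero, hg.1]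
  · intro Z q r
    apply N.code_injective
    rw [code_incl_comp, code_add, code_add, code_incl_comp, code_incl_comp, hg.2]

/-- The endomorphism `[p ; out, 0]`. -/
def step {X : Kleisli N.monad} (p : X ⟶ X) :
    (kleisliCoproducts T S).sum (N.base X) (N.cont X) ⟶
      (kleisliCoproducts T S).sum (N.base X) (N.cont X) :=
  (kleisliCoproducts T S).desc (N.code p) (K.zero _ _)

theorem step_comp {X : Kleisli N.monad} (p : X ⟶ X)
    (r : (kleisliCoproducts T S).sum (N.base X) (N.cont X) ⟶
      (kleisliCoproducts T S).sum (N.base X) (N.cont X)) :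
    N.step K p ≫ r = (kleisliCoproducts T S).desc (N.code p ≫ r) (K.zero _ _) := by
  rw [step, SelectedCoproducts.desc_comp, K.zero_comp]

/-- The iteration operator on the Kleisli category of `T_H`. -/
def iter {X : Kleisli N.monad} (p : X ⟶ X) : X ⟶ X :=
  N.solve ((kleisliCoproducts T S).inl _ _ ≫ K.star (N.step K p))

theorem code_iter {X : Kleisli N.monad} (p : X ⟶ X) :
    N.code (N.iter K p) = (kleisliCoproducts T S).inl _ _ ≫ K.star (N.step K p) ≫
      (kleisliCoproducts T S).map (𝟙 (N.base X)) (N.next (N.iter K p)) := by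
  rw [← Category.assoc]
  exact N.code_solve _

/-- Extends `code_iter` from inl to the whole coproduct, in the shape that `code_comp` produces. -/
theorem desc_code_iter {X : Kleisli N.monad} (p : X ⟶ X) :
    (kleisliCoproducts T S).desc (N.code (N.iter K p))
        (N.next (N.iter K p) ≫ (kleisliCoproducts T S).inr _ _) =
      K.star (N.step K p) ≫
        (kleisliCoproducts T S).map (𝟙 (N.base X)) (N.next (N.iter K p)) := by
  apply (kleisliCoproducts T S).hom_ext
  · rw [SelectedCoproducts.inl_desc, code_iter]
  · rw [SelectedCoproducts.inr_desc, ← Category.assoc, step, K.inr_star,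
      SelectedCoproducts.inr_map]

theorem code_comp_iter {X Y : Kleisli N.monad} (q : X ⟶ Y) (p : Y ⟶ Y) :
    N.code (q ≫ N.iter K p) = N.code q ≫ K.star (N.step K p) ≫
      (kleisliCoproducts T S).map (𝟙 (N.base Y)) (N.next (N.iter K p)) := by
  rw [code_comp, desc_code_iter]

theorem iter_fix {X : Kleisli N.monad} (p : X ⟶ X) :
    N.iter K p = (N.grove K).add (𝟙 X) (p ≫ N.iter K p) := by
  apply N.code_injective
  -- Giving the identity the same tail as the iteration lets the tail factor out of the join,
  -- leaving the fixpoint law in T.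
  have h : N.code (𝟙 X) = (kleisliCoproducts T S).inl _ _ ≫
      (kleisliCoproducts T S).map (𝟙 (N.base X)) (N.next (N.iter K p)) := by
    rw [SelectedCoproducts.inl_map, Category.id_comp, code_id]
  rw [code_add, code_comp_iter, h, ← Category.assoc (N.code p), ← K.add_comp, code_iter,
    ← Category.assoc]
  congr 1
  conv_lhs => rw [K.star_fix, (K.inl_linear _ _).2, Category.comp_id, ← Category.assoc, step,
    SelectedCoproducts.inl_desc]
  rfl

theorem step_add {X : Kleisli N.monad} (p q : X ⟶ X) :
    N.step K ((N.grove K).add p q) = K.add (N.step K p) (N.step K q) := by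
  rw [step, code_add, K.desc_add_zero]; rfl

/-! ### The sum and uniformity laws, and the resulting KiC. -/

variable {K}

/-- With P and Q the steps of p and q, both sides solve the guarded equation for r = inl;P*;(Q;P*)*.
-/
theorem iter_sum (hK : ZeroOrPureTame K) {X : Kleisli N.monad} (p q : X ⟶ X) :
    N.iter K ((N.grove K).add p q) = N.iter K p ≫ N.iter K (q ≫ N.iter K p) := by
  apply N.eq_of_code_eq ((kleisliCoproducts T S).inl _ _ ≫ K.star (N.step K p) ≫
    K.star (N.step K q ≫ K.star (N.step K p)))
  · rw [code_iter, step_add, K.star_sum]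
    simp only [Category.assoc]
  · have h : (kleisliCoproducts T S).inl _ _ ≫ K.star (N.step K (q ≫ N.iter K p)) =
        (kleisliCoproducts T S).inl _ _ ≫ K.star (N.step K q ≫ K.star (N.step K p)) ≫
          (kleisliCoproducts T S).map (𝟙 (N.base X)) (N.next (N.iter K p)) := by
      have := inl_star_naturality K hK (N.code q ≫ K.star (N.step K p))
        (H.map (N.liftHom (N.iter K p)))
      rw [step, code_comp_iter, ← Category.assoc (N.code q)]
      rw [step_comp]
      exact this
    -- Naturality gives this on inl; on inr both iterations are inert.
    have h' : (kleisliCoproducts T S).map (𝟙 (N.base X)) (N.next (N.iter K p)) ≫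
        K.star (N.step K (q ≫ N.iter K p)) =
        K.star (N.step K q ≫ K.star (N.step K p)) ≫
          (kleisliCoproducts T S).map (𝟙 (N.base X)) (N.next (N.iter K p)) := by
      apply (kleisliCoproducts T S).hom_ext
      · rw [SelectedCoproducts.inl_map_assoc, Category.id_comp, h]
      · rw [SelectedCoproducts.inr_map_assoc, step, K.inr_star, step_comp,
          ← Category.assoc, K.inr_star,
          SelectedCoproducts.inr_map]
    rw [code_comp_iter, code_iter, next_comp]
    simp only [Category.assoc]
    rw [← Category.assoc (SelectedCoproducts.map _ _ _), h', Category.assoc,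
      SelectedCoproducts.map_map, Category.comp_id]

theorem iter_uni (hK : ZeroOrPureTame K) {X Y : Kleisli N.monad} (g : N.base X ⟶ N.base Y)
    (hg : K.tame g) (p : Y ⟶ Y) (q : X ⟶ X) (e : N.incl g ≫ p = q ≫ N.incl g) :
    N.incl g ≫ N.iter K p = N.iter K q ≫ N.incl g := by
  have hn := congrArg N.code e
  rw [code_incl_comp, code_comp_incl] at hn
  -- Uniformity is applied with the identity on continuations: `next (incl g)` is absorbed into the
  -- first step of q and then extracted by naturality.
  have h₁ := K.inl_star_of_tame g (𝟙 (N.cont Y)) hg (K.tame_id _)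
    (N.code q ≫ (kleisliCoproducts T S).map (𝟙 _) (N.next (N.incl g))) (N.code p) (by
      rw [Category.assoc, SelectedCoproducts.map_map, Category.id_comp, Category.comp_id, hn])
  have h₂ := inl_star_naturality K hK (N.code q) (H.map (N.liftHom (N.incl g)))
  apply N.eq_of_code_eq ((kleisliCoproducts T S).inl _ _ ≫ K.star (N.step K q) ≫
    (kleisliCoproducts T S).map g (𝟙 _))
  · rw [code_incl_comp, code_iter, next_comp, ← Category.assoc _ (K.star _), ← Category.assoc g]
    refine (congrArg (· ≫ _) h₁).trans ?_
    rw [← Category.assoc]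
    refine (congrArg (fun k => (k ≫ _) ≫ _) h₂).trans ?_
    simp only [Category.assoc]
    change _ ≫ _ ≫ (kleisliCoproducts T S).map _ (N.next _) ≫ _ = _
    simp only [SelectedCoproducts.map_map, Category.id_comp, Category.comp_id]
    rfl
  · rw [code_comp_incl, code_iter, next_comp]
    simp only [Category.assoc, SelectedCoproducts.map_map, Category.id_comp, Category.comp_id]

/-- The Kleisli category of `T_H` as a Kleene-iteration category. -/
def kic (hK : ZeroOrPureTame K) : KiC (Kleisli N.monad) (kleisliCoproducts N.monad S) where
  toIdempotentGrove := N.grove K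
  inl_linear X Y := by
    rw [← incl_inl]
    exact N.incl_linear K _ (K.inl_linear _ _)
  inr_linear X Y := by
    rw [← incl_inr]
    exact N.incl_linear K _ (K.inr_linear _ _)
  tame X Y f := ∃ g : N.base X ⟶ N.base Y, K.tame g ∧ N.incl g = f
  tame_id X := ⟨𝟙 _, K.tame_id _, N.incl_id X⟩
  tame_comp := by
    rintro X Y Z _ _ ⟨f, hf, rfl⟩ ⟨g, hg, rfl⟩
    exact ⟨f ≫ g, K.tame_comp f g hf hg, N.incl_comp f g⟩
  tame_inl X Y := ⟨_, K.tame_inl _ _, N.incl_inl X Y⟩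
  tame_inr X Y := ⟨_, K.tame_inr _ _, N.incl_inr X Y⟩
  tame_desc := by
    rintro X Y Z _ _ ⟨f, hf, rfl⟩ ⟨g, hg, rfl⟩
    exact ⟨_, K.tame_desc f g hf hg, N.incl_desc f g⟩
  tame_linear := by
    rintro X Y _ ⟨g, hg, rfl⟩
    exact N.incl_linear K g (K.tame_linear g hg)
  star p := N.iter K p
  star_fix p := N.iter_fix K p
  star_sum p q := N.iter_sum hK p q
  star_uni := by
    rintro X Y _ p q ⟨g, hg, rfl⟩ e
    exact N.iter_uni hK g hg p q e

/-- Each alternative passes over separately, since `incl` preserves zeros and pure morphisms. -/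
theorem kic_zeroOrPureTame (hK : ZeroOrPureTame K) : ZeroOrPureTame (N.kic hK) := by
  rcases hK with hZ | hP
  · exact Or.inl fun X => ⟨_, hZ (N.base X), N.incl_zero K X X⟩
  · exact Or.inr fun f => ⟨_, hP f, N.incl_pureHom f⟩

theorem eq_iter_iff {X : Kleisli N.monad} (p f : X ⟶ X) :
    f = N.iter K p ↔ (N.compOut f).of = S.inl X.of (H.obj (N.carrier X.of)) ≫
      (K.star (N.step K p)).of ≫ T.map (S.map (𝟙 X.of) (H.map (N.liftHom f))) := by
  have h : N.code f = ((kleisliCoproducts T S).inl _ _ ≫ K.star (N.step K p)) ≫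
        (kleisliCoproducts T S).map (𝟙 (N.base X)) (N.next f) ↔
      (N.compOut f).of = S.inl X.of (H.obj (N.carrier X.of)) ≫
        (K.star (N.step K p)).of ≫ T.map (S.map (𝟙 X.of) (H.map (N.liftHom f))) := by
    have e : (((kleisliCoproducts T S).inl _ _ ≫ K.star (N.step K p)) ≫
        (kleisliCoproducts T S).map (𝟙 (N.base X)) (N.next f)).of =
        S.inl X.of (H.obj (N.carrier X.of)) ≫
          (K.star (N.step K p)).of ≫ T.map (S.map (𝟙 X.of) (H.map (N.liftHom f))) := by
      rw [comp_map_next_of, kleisli_comp_of]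
      refine (congrArg (· ≫ _) ?_).trans (Category.assoc _ _ _)
      change (S.inl _ _ ≫ eta T _) ≫ _ = _
      exact (Category.assoc _ _ _).trans (congrArg _ (unit_klift T _))
    rw [← e]
    exact ⟨fun h => congrArg Kleisli.Hom.of h, fun h => Kleisli.hom_ext h⟩
  rw [← h]
  constructor
  · rintro rfl
    exact N.code_solve _
  · exact N.eq_solve _ f

end FinalCoalgebras

end Resumption

theorem mainTheorem3 {V : Type u} [Category.{v} V] (S : Resumption.SelectedCoproducts V)
    (T : CategoryTheory.Monad V) (H : V ⥤ V) (N : Resumption.FinalCoalgebras T S H)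
    (K : Resumption.KiC (Kleisli T) (Resumption.kleisliCoproducts T S))
    (hK : Resumption.ZeroOrPureTame K) :
    -- the Kleisli category of `T` is a wide subcategory of the Kleisli category of `T_H`
    N.inclusion.Faithful ∧ Function.Bijective N.inclusion.obj ∧
    -- the Kleisli category of `T_H` with the tame morphisms of `T` is a KiC
    ∃ K' : Resumption.KiC (Kleisli N.monad) (Resumption.kleisliCoproducts N.monad S),
      (∀ (X Y : Kleisli N.monad) (f : X ⟶ Y), K'.tame f ↔
        ∃ g : Kleisli.mk T X.of ⟶ Kleisli.mk T Y.of, K.tame g ∧ N.inclusion.map g = f) ∧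
      -- the bottom elements and the joins
      (∀ X Y : Kleisli N.monad, K'.zero X Y = N.compOutInv (K.zero _ _)) ∧
      (∀ (X Y : Kleisli N.monad) (p q : X ⟶ Y),
        K'.add p q = N.compOutInv (K.add (N.compOut p) (N.compOut q))) ∧
      -- the iteration of `p` is the unique solution of its defining equation
      (∀ (X : Kleisli N.monad) (p f : X ⟶ X),
        f = K'.star p ↔
          (N.compOut f).of =
            S.inl X.of (H.obj (N.carrier X.of)) ≫
              (K.star ((Resumption.kleisliCoproducts T S).desc
                (X := Kleisli.mk T X.of) (Y := Kleisli.mk T (H.obj (N.carrier X.of)))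
                (N.compOut p) (K.zero _ _))).of ≫
              T.map (S.map (𝟙 X.of) (H.map (N.liftHom f)))) ∧
      -- the side condition on tame morphisms is inherited
      Resumption.ZeroOrPureTame K' := by
  refine ⟨N.inclusion_faithful K, N.inclusion_obj_bijective, N.kic hK, fun X Y f => Iff.rfl,
    fun X Y => rfl, fun X Y p q => rfl, fun X p f => ?_, N.kic_zeroOrPureTame hK⟩
  exact N.eq_iter_iff p f
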